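/- There exist positive absolute constants $C$ and $c$ such that the following holds. Let $n\ge 2$, let $w_1,\dots,w_n$ be real numbers with $\sum_{i=1}^n w_i=0$ and $\sum_{i=1}^n w_i^2=1$, and let $\pi$ be a random permutation distributed uniformly on the symmetric group of permutations of $\{1,\dots,n\}$. Then, for every $L\in\mathbb R$, $$\mathbb P\Bigl\{\Bigl|\sum_{i=1}^n w_i\,\pi(i)-Ln\Bigr|\le 1\Bigr\}\le \frac{C}{n}\,e^{-c|L|}.$$ -/

import Mathlib

open MeasureTheory

/-- The symmetric group on `n` letters carries the discrete σ-algebra. -/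
instance permFinMeasurableSpace (n : ℕ) : MeasurableSpace (Equiv.Perm (Fin n)) := ⊤

/-- The uniform probability measure on the permutations of `n` letters. -/
noncomputable def uniformPermMeasure (n : ℕ) : Measure (Equiv.Perm (Fin n)) :=
  (PMF.uniformOfFintype (Equiv.Perm (Fin n))).toMeasure

/-- The linear form `∑ wᵢ π(i)`. The letters `1, …, n` are represented by `Fin n`, in which the
letter `i + 1` is the element `i`; so the numerical value of `π i` is `(π i : ℕ) + 1`. -/
noncomputable def permLinearForm {n : ℕ} (w : Fin n → ℝ) (π : Equiv.Perm (Fin n)) : ℝ :=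
  ∑ i : Fin n, w i * (((π i : ℕ) : ℝ) + 1)

/-!
Write `X` for the linear form and `δ` for the largest `|wᵢ|`; after a change of sign of `w` and `L`
some position `i₀` has `w i₀ = δ`. The small ball probability is estimated at the two scales `1` and
`δ n`, by different means.

*From scale `δ n` to scale `1`* (`card_filter_permForm_le`). Since `∑ wᵢ = 0`, at least a third of
the weights are at most `δ / 2`. Let the letter at `i₀` and those at these positions be rearranged,
all other letters and the relative order of the letters at the light positions being kept. When the
letter at `i₀` runs through the available values in increasing order, `X` increases by at least
`δ / 2` per unit of that letter, and by at most `2 δ n` altogether. So at most `8 / δ + 1` of the at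
least `n / 3` arrangements have `X` in a given interval of length `2`, and if one of them has, then
all of them have `X` within `2 δ n + 1` of its centre. Hence
`P(|X - y| ≤ 1) ≤ 27 / (δ n) · P(|X - y| ≤ 3 δ n)`.

*At scale `δ n`* (`card_filter_permForm_le_exp`). An Esseen type inequality, applied to the measure
tilted by `exp (± X / n)`, needs the characteristic function only at frequencies `u` with
`|u| δ n ≤ 1`. About half of the positions are grouped into pairs with weight differences `vₖ`, such
that `∑ vₖ² ≥ 1 / 3`; such a grouping exists by averaging. Exchanging the letters within the
pairs independently replaces `exp (z X)` by a product of hyperbolic cosines, and in the above range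
of frequencies these lie below their values at `u = 0` by factors `exp (-u² vₖ² Dₖ² / 128)`, where
`Dₖ` is the difference of the two letters of a pair (`norm_sum_cexp_permForm_le`). The letters at
the unpaired positions keep the `Dₖ` of order `n` in the mean (`sum_exp_neg_sum_pairGap_sq_le`), and
`exp (± 2 X / n)` has bounded mean (`sum_exp_permForm_le`), so by Cauchy–Schwarz the tilted
characteristic function is `O(exp (-c n² u²))`. Integration gives
`P(|X - L n| ≤ 3 δ n) = O(δ e^{-|L|})`.
-/

/-! ### Averages over permutations -/

/-- The linear form `∑ wᵢ x_{π(i)}` in the positions `i` of an arbitrary finite type. -/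
def permForm {α : Type*} [Fintype α] (w x : α → ℝ) (π : Equiv.Perm α) : ℝ :=
  ∑ i, w i * x (π i)

/-- Right translation invariance of the uniform measure, averaged over a family of translations
that need not be a group. -/
theorem sum_perm_mul_right_family {α T M : Type*} [Fintype α] [DecidableEq α] [Fintype T]
    [AddCommMonoid M] (g : T → Equiv.Perm α) (F : Equiv.Perm α → M) :
    ∑ π, ∑ t, F (π * g t) = Fintype.card T • ∑ π, F π := by
  rw [Finset.sum_comm]
  have : ∀ t, ∑ π, F (π * g t) = ∑ π, F π := fun t =>
    Fintype.sum_equiv (Equiv.mulRight (g t)) _ _ (fun π => rfl)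
  simp [this]

theorem exists_perm_apply_pair {α : Type*} [DecidableEq α] {a b c d : α} (hab : a ≠ b)
    (hcd : c ≠ d) : ∃ ρ : Equiv.Perm α, ρ a = c ∧ ρ b = d := by
  refine ⟨Equiv.swap (Equiv.swap a c b) d * Equiv.swap a c, ?_, ?_⟩
  · have h : c ≠ Equiv.swap a c b := by
      intro h
      rw [← Equiv.swap_apply_left a c] at h
      exact hab ((Equiv.swap a (Equiv.swap a c a)).injective (by simpa using h))
    simp [Equiv.swap_apply_of_ne_of_ne h hcd]
  · simp

/-- Under a uniform permutation two distinct points have a uniform pair of distinct images. -/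
theorem sum_perm_apply_pair {α : Type*} [Fintype α] [DecidableEq α] {a b : α} (hab : a ≠ b)
    (g : α → α → ℝ) (hg : ∀ i, g i i = 0) :
    (Fintype.card α * (Fintype.card α - 1) : ℝ) * ∑ τ : Equiv.Perm α, g (τ a) (τ b) =
      (Fintype.card α).factorial * ∑ i, ∑ j, g i j := by
  have h1 : ∀ c d, c ≠ d →
      ∑ τ : Equiv.Perm α, g (τ c) (τ d) = ∑ τ : Equiv.Perm α, g (τ a) (τ b) := by
    intro c d hcd
    obtain ⟨ρ, rfl, rfl⟩ := exists_perm_apply_pair hab hcd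
    exact Fintype.sum_equiv (Equiv.mulRight ρ) _ _ (fun π => rfl)
  have h2 : ∑ c, ∑ d, ∑ τ : Equiv.Perm α, g (τ c) (τ d) =
      (Fintype.card α).factorial * ∑ i, ∑ j, g i j := by
    calc ∑ c, ∑ d, ∑ τ : Equiv.Perm α, g (τ c) (τ d)
        = ∑ τ : Equiv.Perm α, ∑ c, ∑ d, g (τ c) (τ d) := by
          rw [Finset.sum_congr rfl fun c _ => Finset.sum_comm]
          exact Finset.sum_comm
      _ = ∑ τ : Equiv.Perm α, ∑ i, ∑ j, g i j := by
          refine Finset.sum_congr rfl fun τ _ => ?_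
          rw [← Equiv.sum_comp τ (fun i => ∑ j, g i j)]
          exact Finset.sum_congr rfl fun c _ => Equiv.sum_comp τ (fun j => g (τ c) j)
      _ = _ := by simp [Fintype.card_perm]
  rw [← h2]
  have h3 : ∀ c, ∑ d, ∑ τ : Equiv.Perm α, g (τ c) (τ d) =
      (Fintype.card α - 1 : ℝ) * ∑ τ : Equiv.Perm α, g (τ a) (τ b) := by
    intro c
    rw [← Finset.add_sum_erase _ _ (Finset.mem_univ c)]
    simp only [hg, Finset.sum_const_zero, zero_add]
    rw [Finset.sum_congr rfl fun d hd => h1 c d (Finset.ne_of_mem_erase hd).symm]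
    have : 1 ≤ Fintype.card α := Fintype.card_pos_iff.2 ⟨a⟩
    simp [Finset.card_erase_of_mem, Nat.cast_sub this]
  simp [h3]
  ring

/-- Integers in a real interval of length `t` number at most `t + 1`. -/
theorem card_le_of_injOn_int {α : Type*} (s : Finset α) (f : α → ℤ) (hf : Set.InjOn f s)
    {l t : ℝ} (ht : 0 ≤ t) (h : ∀ a ∈ s, l ≤ f a ∧ f a ≤ l + t) : (s.card : ℝ) ≤ t + 1 := by
  have h1 : s.card ≤ (Finset.Icc ⌈l⌉ ⌊l + t⌋).card :=
    Finset.card_le_card_of_injOn f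
      (fun a ha => Finset.mem_coe.2 (Finset.mem_Icc.2
        ⟨Int.ceil_le.2 (h a ha).1, Int.le_floor.2 (h a ha).2⟩)) hf
  rw [Int.card_Icc] at h1
  rcases le_total 0 (⌊l + t⌋ + 1 - ⌈l⌉) with h0 | h0
  · have h2 : (s.card : ℝ) ≤ ((⌊l + t⌋ + 1 - ⌈l⌉ : ℤ) : ℝ) := by
      have : (s.card : ℤ) ≤ ⌊l + t⌋ + 1 - ⌈l⌉ := by omega
      exact_mod_cast this
    push_cast at h2
    linarith [Int.floor_le (l + t), Int.le_ceil l]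
  · have : s.card = 0 := by omega
    rw [this]; push_cast; linarith

/-! ### Exchanging the members of pairs -/

/-- The positions, split into `m` ordered pairs and `r` unpaired ones. -/
abbrev PairedIndex (m r : ℕ) : Type := Fin m × Bool ⊕ Fin r

/-- The difference of `f` over the two members of the `k`-th pair. -/
def pairGap {m r : ℕ} (f : PairedIndex m r → ℝ) (k : Fin m) : ℝ :=
  f (.inl (k, true)) - f (.inl (k, false))

/-- The involution exchanging the members of those pairs `k` for which `ε k` is true. -/
def pairFlip {m r : ℕ} (ε : Fin m → Bool) : Equiv.Perm (PairedIndex m r) :=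
  Equiv.sumCongr
    (Equiv.prodShear (Equiv.refl _) fun k => bif ε k then Equiv.boolNot else Equiv.refl _)
    (Equiv.refl _)

theorem pairGap_comp_pairFlip {m r : ℕ} (f : PairedIndex m r → ℝ) (ε : Fin m → Bool) (k : Fin m) :
    pairGap (f ∘ pairFlip ε) k = (bif ε k then -1 else 1) * pairGap f k := by
  cases h : ε k <;> simp [pairGap, pairFlip, h]

/-- The part of `permForm` that does not change when the members of a pair are exchanged. -/
noncomputable def pairMid {m r : ℕ} (w x : PairedIndex m r → ℝ)
    (π : Equiv.Perm (PairedIndex m r)) : ℝ :=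
  ∑ k : Fin m, (w (.inl (k, true)) + w (.inl (k, false))) *
      (x (π (.inl (k, true))) + x (π (.inl (k, false)))) / 2 +
    ∑ j : Fin r, w (.inr j) * x (π (.inr j))

theorem permForm_eq_pairMid_add {m r : ℕ} (w x : PairedIndex m r → ℝ)
    (π : Equiv.Perm (PairedIndex m r)) :
    permForm w x π = pairMid w x π + ∑ k, pairGap w k * pairGap (x ∘ π) k / 2 := by
  simp only [permForm, pairMid, pairGap, Fintype.sum_sum_type, Fintype.sum_prod_type,
    Fintype.sum_bool, Function.comp]
  rw [add_right_comm, ← Finset.sum_add_distrib]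
  congr 1
  exact Finset.sum_congr rfl fun k _ => by ring

theorem pairMid_mul_pairFlip {m r : ℕ} (w x : PairedIndex m r → ℝ)
    (π : Equiv.Perm (PairedIndex m r)) (ε : Fin m → Bool) :
    pairMid w x (π * pairFlip ε) = pairMid w x π := by
  unfold pairMid
  congr 1
  refine Finset.sum_congr rfl fun k _ => ?_
  cases h : ε k <;> simp [pairFlip, h]
  left; ring

/-- The expansion of `∏ₖ (E (cₖ) + E (-cₖ))` over choices of signs. It is used for both the real and
the complex exponential, so `E` is any function turning sums into products. -/
theorem sum_signs_map_add {m : ℕ} {R : Type*} [CommRing R] (E : ℝ → R) (h0 : E 0 = 1)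
    (hE : ∀ a b, E (a + b) = E a * E b) (μ : ℝ) (c : Fin m → ℝ) :
    ∑ ε : Fin m → Bool, E (μ + ∑ k, (bif ε k then -1 else 1) * c k) =
      E μ * ∏ k, (E (c k) + E (-c k)) := by
  have hs : ∀ f : Fin m → ℝ, E (∑ k, f k) = ∏ k, E (f k) := by
    intro f
    -- `E` as a monoid homomorphism, so that `map_prod` applies.
    let φ : Multiplicative ℝ →* R := ⟨⟨fun a => E a.toAdd, h0⟩, fun a b => hE _ _⟩
    have := map_prod φ (fun k => Multiplicative.ofAdd (f k)) Finset.univ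
    rw [← ofAdd_sum] at this
    exact this
  simp_rw [hE μ, hs]
  rw [← Finset.mul_sum]
  congr 1
  have h := (Finset.prod_univ_sum (fun _ : Fin m => (Finset.univ : Finset Bool))
    (fun k b => E ((bif b then -1 else 1) * c k))).symm
  rw [Fintype.piFinset_univ] at h
  rw [h]
  refine Finset.prod_congr rfl fun k _ => ?_
  simp [add_comm]

theorem sum_map_permForm_mul_pairFlip {m r : ℕ} {R : Type*} [CommRing R] (E : ℝ → R)
    (h0 : E 0 = 1) (hE : ∀ a b, E (a + b) = E a * E b) (w x : PairedIndex m r → ℝ)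
    (π : Equiv.Perm (PairedIndex m r)) :
    ∑ ε, E (permForm w x (π * pairFlip ε)) =
      E (pairMid w x π) * ∏ k, (E (pairGap w k * pairGap (x ∘ π) k / 2) +
        E (-(pairGap w k * pairGap (x ∘ π) k / 2))) := by
  rw [← sum_signs_map_add E h0 hE]
  refine Finset.sum_congr rfl fun ε _ => ?_
  rw [permForm_eq_pairMid_add, pairMid_mul_pairFlip]
  congr 2
  refine Finset.sum_congr rfl fun k _ => ?_
  have : x ∘ ⇑(π * pairFlip ε : Equiv.Perm (PairedIndex m r)) = (x ∘ π) ∘ pairFlip ε := rfl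
  rw [this, pairGap_comp_pairFlip]
  ring

/-- From `‖cosh (a + b i)‖² = cosh² a - sin² b`. -/
theorem norm_cosh_le {a b : ℝ} (ha : |a| ≤ 1) (hb : |b| ≤ 1) :
    ‖Complex.cosh (a + b * Complex.I)‖ ≤ Real.cosh a * Real.exp (-(b ^ 2 / 32)) := by
  have h1 : ‖Complex.cosh (a + b * Complex.I)‖ ^ 2 = Real.cosh a ^ 2 - Real.sin b ^ 2 := by
    rw [← Complex.normSq_eq_norm_sq, Complex.cosh_add, Complex.cosh_mul_I,
      Complex.sinh_mul_I, ← Complex.ofReal_cosh,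
      ← Complex.ofReal_cos, ← Complex.ofReal_sinh, ← Complex.ofReal_sin, Complex.normSq_apply]
    simp only [Complex.add_re, Complex.mul_re, Complex.add_im, Complex.mul_im, Complex.ofReal_re,
      Complex.ofReal_im, Complex.I_re, Complex.I_im, mul_zero, mul_one, sub_zero, add_zero,
      zero_mul, zero_add, sub_self]
    have h1 := Real.cosh_sq a
    have h2 := Real.sin_sq_add_cos_sq b
    linear_combination Real.cosh a ^ 2 * h2 - Real.sin b ^ 2 * h1
  have h2 : b ^ 2 / 4 ≤ Real.sin b ^ 2 := by
    have key : ∀ c : ℝ, 0 ≤ c → c ≤ 1 → c / 2 ≤ Real.sin c := by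
      intro c h0 h1
      have h3 := Real.mul_le_sin h0 (by linarith [Real.pi_gt_three])
      have : (1 : ℝ) / 2 ≤ 2 / Real.pi := by
        rw [div_le_div_iff₀ (by norm_num) Real.pi_pos]; linarith [Real.pi_le_four]
      nlinarith
    have h3 := key |b| (abs_nonneg b) hb
    have h4 : Real.sin |b| ^ 2 = Real.sin b ^ 2 := by
      rcases abs_choice b with h | h <;> rw [h]
      simp
    rw [← h4, ← sq_abs b]
    nlinarith [abs_nonneg b]
  have h3 : Real.cosh a ^ 2 ≤ 4 := by
    have : Real.cosh a ≤ Real.cosh 1 := Real.cosh_le_cosh.2 (by simpa using ha)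
    have h5 : Real.cosh 1 ≤ 2 := by
      have := Real.exp_one_lt_d9
      have h6 : Real.exp (-1) ≤ 1 := Real.exp_le_one_iff.2 (by norm_num)
      rw [Real.cosh_eq]; linarith
    nlinarith [Real.cosh_pos a]
  refine abs_le_of_sq_le_sq' ?_ (by positivity) |>.2
  rw [h1, mul_pow, ← Real.exp_nat_mul]
  have h4 : 1 - b ^ 2 / 16 ≤ Real.exp (((2 : ℕ) : ℝ) * -(b ^ 2 / 32)) := by
    have := Real.add_one_le_exp (((2 : ℕ) : ℝ) * -(b ^ 2 / 32))
    push_cast at this ⊢; linarith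
  nlinarith [sq_nonneg (Real.cosh a), sq_nonneg b]

/-- The quadratic form `∑ vₖ² Dₖ²`, with `vₖ` the gap of `w` and `Dₖ` the gap of the letters over
the `k`-th pair; it governs the decay of the characteristic function. -/
noncomputable def pairQuad {m r : ℕ} (w x : PairedIndex m r → ℝ)
    (π : Equiv.Perm (PairedIndex m r)) : ℝ :=
  ∑ k, pairGap w k ^ 2 * pairGap (x ∘ π) k ^ 2

theorem pairQuad_mul_pairFlip {m r : ℕ} (w x : PairedIndex m r → ℝ)
    (π : Equiv.Perm (PairedIndex m r)) (ε : Fin m → Bool) :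
    pairQuad w x (π * pairFlip ε) = pairQuad w x π := by
  refine Finset.sum_congr rfl fun k _ => ?_
  have : x ∘ ⇑(π * pairFlip ε : Equiv.Perm (PairedIndex m r)) = (x ∘ π) ∘ pairFlip ε := rfl
  rw [this, pairGap_comp_pairFlip]
  cases ε k <;> simp

/-- Gaussian decay of the tilted characteristic function, conditionally on the unordered pairs of
letters. Averaging `exp (z X)` over the exchanges gives a product of hyperbolic cosines; once the
decay is split off, those at frequency `0` are expanded again into an average of exchanges. -/
theorem norm_sum_cexp_permForm_le {m r : ℕ} (w x : PairedIndex m r → ℝ) (p u : ℝ)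
    (hp : ∀ π k, |p * (pairGap w k * pairGap (x ∘ ⇑(π : Equiv.Perm (PairedIndex m r))) k / 2)| ≤ 1)
    (hu : ∀ π k,
      |u * (pairGap w k * pairGap (x ∘ ⇑(π : Equiv.Perm (PairedIndex m r))) k / 2)| ≤ 1) :
    ‖∑ π, Complex.exp ((p + u * Complex.I) * permForm w x π)‖ ≤
      ∑ π, Real.exp (p * permForm w x π) * Real.exp (-(u ^ 2 * pairQuad w x π / 128)) := by
  have hC := sum_perm_mul_right_family (pairFlip (m := m) (r := r))
    (fun π => Complex.exp ((p + u * Complex.I) * permForm w x π))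
  have hR := sum_perm_mul_right_family (pairFlip (m := m) (r := r))
    (fun π => Real.exp (p * permForm w x π) * Real.exp (-(u ^ 2 * pairQuad w x π / 128)))
  have hpos : (0 : ℝ) < Fintype.card (Fin m → Bool) := by exact_mod_cast Fintype.card_pos
  refine le_of_mul_le_mul_left ?_ hpos
  rw [nsmul_eq_mul] at hC hR
  rw [← hR]
  have : (Fintype.card (Fin m → Bool) : ℝ) *
      ‖∑ π, Complex.exp ((p + u * Complex.I) * permForm w x π)‖ =
      ‖(Fintype.card (Fin m → Bool) : ℂ) *
        ∑ π, Complex.exp ((p + u * Complex.I) * permForm w x π)‖ := by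
    rw [norm_mul, Complex.norm_natCast]
  rw [this, ← hC]
  refine (norm_sum_le _ _).trans (Finset.sum_le_sum fun π _ => ?_)
  simp_rw [pairQuad_mul_pairFlip]
  rw [← Finset.sum_mul]
  rw [sum_map_permForm_mul_pairFlip (fun a : ℝ => Complex.exp ((p + u * Complex.I) * a))
    (by simp) (by intro a b; simp [mul_add, Complex.exp_add])]
  rw [sum_map_permForm_mul_pairFlip (fun a : ℝ => Real.exp (p * a))
    (by simp) (by intro a b; simp [mul_add, Real.exp_add])]
  rw [norm_mul, norm_prod, mul_assoc]
  have h1 : ‖Complex.exp ((p + u * Complex.I) * (pairMid w x π : ℝ))‖ =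
      Real.exp (p * pairMid w x π) := by
    rw [Complex.norm_exp]; simp
  rw [h1]
  refine mul_le_mul_of_nonneg_left ?_ (Real.exp_pos _).le
  have h2 : Real.exp (-(u ^ 2 * pairQuad w x π / 128)) =
      ∏ k, Real.exp (-((u * (pairGap w k * pairGap (x ∘ π) k / 2)) ^ 2 / 32)) := by
    rw [← Real.exp_sum]
    congr 1
    rw [pairQuad, Finset.mul_sum, Finset.sum_div, ← Finset.sum_neg_distrib]
    exact Finset.sum_congr rfl fun k _ => by ring
  rw [h2, ← Finset.prod_mul_distrib]
  refine Finset.prod_le_prod (fun k _ => norm_nonneg _) fun k _ => ?_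
  have h3 := norm_cosh_le (hp π k) (hu π k)
  set c := pairGap w k * pairGap (x ∘ π) k / 2
  have h4 : Complex.exp ((p + u * Complex.I) * (c : ℝ)) +
      Complex.exp ((p + u * Complex.I) * ((-c : ℝ) : ℂ)) =
      2 * Complex.cosh (((p * c : ℝ) : ℂ) + ((u * c : ℝ) : ℂ) * Complex.I) := by
    rw [Complex.two_cosh]; push_cast; congr 2 <;> ring
  have h5 : Real.exp (p * c) + Real.exp (p * -c) = 2 * Real.cosh (p * c) := by
    rw [Real.cosh_eq]; ring_nf
  rw [h4, h5, norm_mul, Complex.norm_ofNat, mul_assoc]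
  linarith

/-! ### Moments, a good pairing, and sampling without replacement -/

theorem permForm_comp_equiv {α β : Type*} [Fintype α] [Fintype β] (e : α ≃ β) (w x : β → ℝ)
    (π : Equiv.Perm β) :
    permForm (w ∘ e) (x ∘ e) (e.symm.permCongr π) = permForm w x π := by
  unfold permForm
  rw [← Equiv.sum_comp e (fun i => w i * x (π i))]
  simp [Equiv.permCongr_apply]

theorem sum_sum_sub_mul_sub {α : Type*} [Fintype α] (w y : α → ℝ) (hw : ∑ i, w i = 0) :
    ∑ i, ∑ j, (w i - w j) * (y i - y j) = 2 * Fintype.card α * ∑ i, w i * y i := by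
  have : ∀ i j, (w i - w j) * (y i - y j) = w i * y i - w i * y j - w j * y i + w j * y j :=
    fun i j => by ring
  simp_rw [this, Finset.sum_add_distrib, Finset.sum_sub_distrib, ← Finset.mul_sum,
    ← Finset.sum_mul, hw]
  simp only [Finset.sum_const, Finset.card_univ, nsmul_eq_mul, mul_zero, sub_zero, zero_mul,
    mul_left_comm (w _) (Fintype.card α : ℝ), ← Finset.mul_sum]
  ring

/-- Averaging the pair form over all relabellings `τ` of the positions gives back a multiple of
the linear form. -/
theorem sum_perm_sum_pairGap_mul {m r : ℕ} (w y : PairedIndex m r → ℝ) (hw : ∑ i, w i = 0) :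
    ((2 * m + r : ℕ) - 1 : ℝ) *
      ∑ τ : Equiv.Perm (PairedIndex m r), ∑ k, pairGap (w ∘ τ) k * pairGap (y ∘ τ) k =
      (2 * m + r).factorial * (2 * m * ∑ i, w i * y i) := by
  have hcard : Fintype.card (PairedIndex m r) = 2 * m + r := by simp; ring
  rcases Nat.eq_zero_or_pos m with rfl | hm
  · simp
  have h1 : ∀ k : Fin m, ((2 * m + r : ℕ) : ℝ) * (((2 * m + r : ℕ) : ℝ) - 1) *
      ∑ τ : Equiv.Perm (PairedIndex m r), pairGap (w ∘ τ) k * pairGap (y ∘ τ) k =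
      (2 * m + r).factorial * (2 * (2 * m + r : ℕ) * ∑ i, w i * y i) := by
    intro k
    have := sum_perm_apply_pair (α := PairedIndex m r) (a := .inl (k, true))
      (b := .inl (k, false)) (by simp) (fun i j => (w i - w j) * (y i - y j)) (by simp)
    rw [sum_sum_sub_mul_sub w y hw, hcard] at this
    exact this
  have hpos : (0 : ℝ) < (2 * m + r : ℕ) := by exact_mod_cast (by omega)
  refine mul_left_cancel₀ hpos.ne' ?_
  rw [Finset.sum_comm, ← mul_assoc, Finset.mul_sum, Finset.sum_congr rfl fun k _ => h1 k]
  simp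
  ring

/-- The average of the sum over all relabellings `τ` is `2 m / (2 m + r - 1)`. -/
theorem exists_perm_sum_pairGap_sq {m r : ℕ} (hm : 1 ≤ m) (hr : r ≤ 2 * m + 3)
    (w : PairedIndex m r → ℝ) (hw : ∑ i, w i = 0)
    (hw2 : ∑ i, w i ^ 2 = 1) :
    ∃ τ : Equiv.Perm (PairedIndex m r), 1 / 3 ≤ ∑ k, pairGap (w ∘ τ) k ^ 2 := by
  have h := sum_perm_sum_pairGap_mul w w hw
  simp_rw [← sq, hw2] at h
  by_contra! hlt
  have hcard : Fintype.card (PairedIndex m r) = 2 * m + r := by simp; ring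
  have h1 : ∑ τ : Equiv.Perm (PairedIndex m r), ∑ k, pairGap (w ∘ τ) k ^ 2 <
      ∑ τ : Equiv.Perm (PairedIndex m r), (1 / 3 : ℝ) :=
    Finset.sum_lt_sum_of_nonempty Finset.univ_nonempty fun τ _ => hlt τ
  rw [Finset.sum_const, Finset.card_univ, Fintype.card_perm, hcard, nsmul_eq_mul] at h1
  have hm' : (1 : ℝ) ≤ m := by exact_mod_cast hm
  have hr' : (r : ℝ) ≤ 2 * m + 3 := by exact_mod_cast hr
  have hr0 : (0 : ℝ) ≤ r := by positivity
  have h2 : (0 : ℝ) < ((2 * m + r : ℕ) - 1 : ℝ) := by push_cast; linarith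
  have h3 := mul_lt_mul_of_pos_left h1 h2
  rw [h] at h3
  have hf : (0 : ℝ) < (2 * m + r).factorial := by positivity
  have h4 : (2 * m * 1 : ℝ) < ((2 * m + r : ℕ) - 1 : ℝ) * (1 / 3) := by
    refine lt_of_mul_lt_mul_left ?_ hf.le
    linarith
  push_cast at h4
  linarith

theorem sum_pairGap_sq_le {m r : ℕ} (w : PairedIndex m r → ℝ) :
    ∑ k, pairGap w k ^ 2 ≤ 2 * ∑ i, w i ^ 2 := by
  simp only [Fintype.sum_sum_type, Fintype.sum_prod_type, Fintype.sum_bool, mul_add,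
    Finset.mul_sum]
  have h0 : 0 ≤ ∑ j : Fin r, 2 * w (.inr j) ^ 2 := by positivity
  refine le_add_of_le_of_nonneg (Finset.sum_le_sum fun k _ => ?_) h0
  unfold pairGap
  nlinarith [sq_nonneg (w (.inl (k, true)) + w (.inl (k, false)))]

/-- A Hoeffding bound: given the unordered pairs of letters, the signs of the differences are
independent. -/
theorem sum_exp_sum_pairGap_le {m r : ℕ} (c : Fin m → ℝ) (x : PairedIndex m r → ℝ) (M : ℝ)
    (hx : ∀ i j, |x i - x j| ≤ M) :
    ∑ π : Equiv.Perm (PairedIndex m r), Real.exp (∑ k, c k * pairGap (x ∘ π) k) ≤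
      (2 * m + r).factorial * Real.exp (M ^ 2 / 2 * ∑ k, c k ^ 2) := by
  have hcard : Fintype.card (PairedIndex m r) = 2 * m + r := by simp; ring
  have hR := sum_perm_mul_right_family (pairFlip (m := m) (r := r))
    (fun π => Real.exp (∑ k, c k * pairGap (x ∘ π) k))
  have hpos : (0 : ℝ) < Fintype.card (Fin m → Bool) := by exact_mod_cast Fintype.card_pos
  refine le_of_mul_le_mul_left ?_ hpos
  rw [nsmul_eq_mul] at hR
  rw [← hR]
  have : ∀ π ∈ (Finset.univ : Finset (Equiv.Perm (PairedIndex m r))),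
      ∑ ε, Real.exp (∑ k, c k * pairGap (x ∘ ⇑(π * pairFlip ε : Equiv.Perm (PairedIndex m r))) k)
      ≤ Fintype.card (Fin m → Bool) * Real.exp (M ^ 2 / 2 * ∑ k, c k ^ 2) := by
    intro π _
    have h1 := sum_signs_map_add Real.exp Real.exp_zero Real.exp_add 0
      (fun k => c k * pairGap (x ∘ π) k)
    have h2 : ∀ ε, ∑ k, c k * pairGap (x ∘ ⇑(π * pairFlip ε : Equiv.Perm (PairedIndex m r))) k =
        0 + ∑ k, (bif ε k then -1 else 1) * (c k * pairGap (x ∘ π) k) := by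
      intro ε
      rw [zero_add]
      refine Finset.sum_congr rfl fun k _ => ?_
      have : x ∘ ⇑(π * pairFlip ε : Equiv.Perm (PairedIndex m r)) = (x ∘ π) ∘ pairFlip ε := rfl
      rw [this, pairGap_comp_pairFlip]
      ring
    simp_rw [h2, h1, Real.exp_zero, one_mul]
    have h3 : (Fintype.card (Fin m → Bool) : ℝ) * Real.exp (M ^ 2 / 2 * ∑ k, c k ^ 2) =
        ∏ k, (2 * Real.exp (M ^ 2 / 2 * c k ^ 2)) := by
      rw [Finset.prod_mul_distrib, ← Real.exp_sum, Finset.mul_sum]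
      simp
    rw [h3]
    refine Finset.prod_le_prod (fun k _ => by positivity) fun k _ => ?_
    have h4 := Real.cosh_le_exp_half_sq (c k * pairGap (x ∘ π) k)
    rw [Real.cosh_eq] at h4
    have h5 : Real.exp ((c k * pairGap (x ∘ π) k) ^ 2 / 2) ≤ Real.exp (M ^ 2 / 2 * c k ^ 2) := by
      rw [Real.exp_le_exp]
      have h6 : pairGap (x ∘ π) k ^ 2 ≤ M ^ 2 := by
        have := hx (π (.inl (k, true))) (π (.inl (k, false)))
        exact sq_le_sq' (abs_le.1 this).1 (abs_le.1 this).2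
      nlinarith [sq_nonneg (c k)]
    linarith
  refine (Finset.sum_le_sum this).trans (le_of_eq ?_)
  rw [Finset.sum_const, Finset.card_univ, Fintype.card_perm, hcard, nsmul_eq_mul]
  ring

/-- Sub-Gaussian tails of the linear form: it is an average of pair forms over the relabellings of
the positions (`sum_perm_sum_pairGap_mul`), so Jensen's inequality reduces the claim to
`sum_exp_sum_pairGap_le`. -/
theorem sum_exp_permForm_le {m r : ℕ} (hm : 1 ≤ m) (w x : PairedIndex m r → ℝ)
    (hw : ∑ i, w i = 0) (hw2 : ∑ i, w i ^ 2 = 1) (M : ℝ) (hx : ∀ i j, |x i - x j| ≤ M) (p : ℝ) :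
    ∑ π, Real.exp (p * permForm w x π) ≤
      (2 * m + r).factorial * Real.exp ((p * M * ((2 * m + r : ℕ) - 1) / (2 * m)) ^ 2) := by
  have hcard : Fintype.card (PairedIndex m r) = 2 * m + r := by simp; ring
  set n := 2 * m + r with hn
  -- `l` is `p` times the inverse of the factor by which averaging scales the linear form.
  set l : ℝ := p * ((n : ℝ) - 1) / (2 * m) with hl
  have hm' : (0 : ℝ) < m := by exact_mod_cast hm
  have hf : (0 : ℝ) < n.factorial := by positivity
  have h1 : ∀ π : Equiv.Perm (PairedIndex m r), Real.exp (p * permForm w x π) ≤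
      ∑ τ : Equiv.Perm (PairedIndex m r), (n.factorial : ℝ)⁻¹ *
        Real.exp (∑ k, l * pairGap (w ∘ τ) k * pairGap (x ∘ ⇑(π * τ)) k) := by
    intro π
    have h2 := sum_perm_sum_pairGap_mul w (x ∘ π) hw
    have h3 : p * permForm w x π = ∑ τ : Equiv.Perm (PairedIndex m r), (n.factorial : ℝ)⁻¹ *
        (∑ k, l * pairGap (w ∘ τ) k * pairGap (x ∘ ⇑(π * τ)) k) := by
      have h4 : permForm w x π = ∑ i, w i * (x ∘ π) i := rfl
      simp_rw [mul_assoc l, ← Finset.mul_sum]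
      have h5 : ∀ τ : Equiv.Perm (PairedIndex m r), x ∘ ⇑(π * τ) = (x ∘ π) ∘ τ := fun _ => rfl
      simp_rw [h5]
      have h6 : permForm w x π = ((n : ℝ) - 1) * (∑ τ : Equiv.Perm (PairedIndex m r),
          ∑ k, pairGap (w ∘ τ) k * pairGap ((x ∘ π) ∘ τ) k) / (n.factorial * (2 * m)) := by
        rw [← hn] at h2
        rw [h2, h4]
        field_simp
      rw [h6, hl]
      field_simp
    rw [h3]
    exact convexOn_exp.map_sum_le (fun _ _ => by positivity)
      (by simp [Fintype.card_perm, hcard, hf.ne'])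
      (fun _ _ => Set.mem_univ _)
  refine (Finset.sum_le_sum fun π _ => h1 π).trans ?_
  rw [Finset.sum_comm]
  have h7 : ∀ τ ∈ (Finset.univ : Finset (Equiv.Perm (PairedIndex m r))),
      ∑ π : Equiv.Perm (PairedIndex m r), (n.factorial : ℝ)⁻¹ *
        Real.exp (∑ k, l * pairGap (w ∘ τ) k * pairGap (x ∘ ⇑(π * τ)) k) ≤
      Real.exp ((p * M * ((n : ℝ) - 1) / (2 * m)) ^ 2) := by
    intro τ _
    rw [Fintype.sum_equiv (Equiv.mulRight τ) (fun π => (n.factorial : ℝ)⁻¹ *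
        Real.exp (∑ k, l * pairGap (w ∘ τ) k * pairGap (x ∘ ⇑(π * τ)) k))
        (fun π => (n.factorial : ℝ)⁻¹ *
        Real.exp (∑ k, l * pairGap (w ∘ τ) k * pairGap (x ∘ π) k)) (fun π => rfl)]
    rw [← Finset.mul_sum, inv_mul_le_iff₀ hf]
    refine (sum_exp_sum_pairGap_le _ x M hx).trans ?_
    refine mul_le_mul_of_nonneg_left (Real.exp_le_exp.2 ?_) hf.le
    have h8 := sum_pairGap_sq_le (w ∘ τ)
    have h9 : ∑ i, (w ∘ τ) i ^ 2 = 1 := by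
      rw [← hw2]; exact Equiv.sum_comp τ (fun i => w i ^ 2)
    rw [h9] at h8
    simp_rw [mul_pow, ← Finset.mul_sum]
    calc M ^ 2 / 2 * (l ^ 2 * ∑ k, pairGap (w ∘ τ) k ^ 2)
        ≤ M ^ 2 / 2 * (l ^ 2 * (2 * 1)) := by gcongr
      _ = _ := by rw [hl]; ring
  refine (Finset.sum_le_sum h7).trans (le_of_eq ?_)
  rw [Finset.sum_const, Finset.card_univ, Fintype.card_perm, hcard, nsmul_eq_mul]

/-- At least half of `r ≥ N / 2` distinct integers are at distance at least `N / 16` from `a`. -/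
theorem sum_exp_neg_sq_dist_le {r : ℕ} (y : Fin r → ℤ) (hy : Function.Injective y) (a N c : ℝ)
    (hN : 8 ≤ N) (hr : N / 2 ≤ r) (hc0 : 0 ≤ c) (hc : c * N ^ 2 ≤ 256) :
    ∑ ρ, Real.exp (-(c * ((y ρ : ℝ) - a) ^ 2)) ≤ r * Real.exp (-(c * N ^ 2 / 1024)) := by
  classical
  set near := Finset.univ.filter fun ρ => |(y ρ : ℝ) - a| ≤ N / 16
  have h1 : (near.card : ℝ) ≤ r / 2 := by
    have := card_le_of_injOn_int near y hy.injOn (l := a - N / 16) (t := N / 8) (by linarith)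
      (fun ρ hρ => by
        have := abs_le.1 (Finset.mem_filter.1 hρ).2
        constructor <;> linarith)
    linarith
  set z := c * N ^ 2 / 256 with hz
  have hz0 : 0 ≤ z := by positivity
  have hz1 : z ≤ 1 := by rw [hz]; linarith
  have h2 : ∀ ρ, Real.exp (-(c * ((y ρ : ℝ) - a) ^ 2)) ≤
      (1 - z / 2) + (z / 2) * (if |(y ρ : ℝ) - a| ≤ N / 16 then 1 else 0) := by
    intro ρ
    split_ifs with h
    · rw [mul_one, sub_add_cancel, Real.exp_le_one_iff, neg_nonpos]; positivity
    · have h3 : z ≤ c * ((y ρ : ℝ) - a) ^ 2 := by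
        have : (N / 16) ^ 2 ≤ ((y ρ : ℝ) - a) ^ 2 := by
          rw [← sq_abs ((y ρ : ℝ) - a)]
          push Not at h
          gcongr
        rw [hz]; nlinarith
      have h4 : Real.exp (-z) ≤ 1 - z / 2 := by
        rw [Real.exp_neg]
        rw [inv_le_comm₀ (Real.exp_pos _) (by linarith)]
        refine le_trans ?_ (Real.add_one_le_exp z)
        rw [inv_le_iff_one_le_mul₀ (by linarith)]
        nlinarith
      have := Real.exp_le_exp.2 (neg_le_neg h3)
      linarith
  refine (Finset.sum_le_sum fun ρ _ => h2 ρ).trans ?_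
  rw [Finset.sum_add_distrib, ← Finset.mul_sum, Finset.sum_boole]
  simp only [Finset.sum_const, Finset.card_univ, Fintype.card_fin, nsmul_eq_mul]
  have h5 := Real.add_one_le_exp (-(c * N ^ 2 / 1024))
  have h6 : (r : ℝ) * (1 - z / 4) ≤ r * Real.exp (-(c * N ^ 2 / 1024)) := by
    refine mul_le_mul_of_nonneg_left ?_ (by positivity)
    rw [hz]; linarith
  have h7 : z / 2 * (near.card : ℝ) ≤ z / 2 * (r / 2) := by gcongr
  linarith

/-- The pairs are removed one at a time: exchanging the letter at one member of the `k`-th pair with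
a random unpaired one affects no other pair, and makes that letter uniform on a set of at least
`N / 2` values. -/
theorem sum_exp_neg_sum_pairGap_sq_le {m r : ℕ} (x : PairedIndex m r → ℤ)
    (hx : Function.Injective x) (N : ℝ) (hN : 8 ≤ N) (hr : N / 2 ≤ r) (c : Fin m → ℝ)
    (hc0 : ∀ k, 0 ≤ c k) (hc : ∀ k, c k * N ^ 2 ≤ 256) (s : Finset (Fin m)) :
    ∑ π : Equiv.Perm (PairedIndex m r),
        Real.exp (-∑ k ∈ s, c k * pairGap ((fun i => (x i : ℝ)) ∘ π) k ^ 2) ≤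
      (2 * m + r).factorial * Real.exp (-(N ^ 2 / 1024 * ∑ k ∈ s, c k)) := by
  classical
  have hcard : Fintype.card (PairedIndex m r) = 2 * m + r := by simp; ring
  induction s using Finset.induction_on with
  | empty => simp [Fintype.card_perm, hcard]
  | insert k s hk ih =>
    have hr0 : (0 : ℝ) < r := by linarith
    refine le_of_mul_le_mul_left ?_ hr0
    have h := sum_perm_mul_right_family
      (fun ρ : Fin r => Equiv.swap (.inl (k, true) : PairedIndex m r) (.inr ρ))
      (fun π => Real.exp (-∑ k ∈ insert k s, c k * pairGap ((fun i => (x i : ℝ)) ∘ π) k ^ 2))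
    rw [nsmul_eq_mul, Fintype.card_fin] at h
    rw [← h]
    have h1 : ∀ (π : Equiv.Perm (PairedIndex m r)) (ρ : Fin r), ∀ l ∈ s,
        pairGap ((fun i => (x i : ℝ)) ∘
          ⇑(π * Equiv.swap (.inl (k, true) : PairedIndex m r) (.inr ρ))) l =
        pairGap ((fun i => (x i : ℝ)) ∘ π) l := by
      intro π ρ l hl
      have : l ≠ k := fun h => hk (h ▸ hl)
      simp only [pairGap, Function.comp, Equiv.Perm.mul_apply]
      rw [Equiv.swap_apply_of_ne_of_ne (by simp [this]) (by simp),
        Equiv.swap_apply_of_ne_of_ne (by simp) (by simp)]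
    have h2 : ∀ (π : Equiv.Perm (PairedIndex m r)) (ρ : Fin r),
        pairGap ((fun i => (x i : ℝ)) ∘
          ⇑(π * Equiv.swap (.inl (k, true) : PairedIndex m r) (.inr ρ))) k =
        (x (π (.inr ρ)) : ℝ) - x (π (.inl (k, false))) := by
      intro π ρ
      simp only [pairGap, Function.comp, Equiv.Perm.mul_apply]
      rw [Equiv.swap_apply_left, Equiv.swap_apply_of_ne_of_ne (by simp) (by simp)]
    have h3 : ∀ π ∈ (Finset.univ : Finset (Equiv.Perm (PairedIndex m r))),
        ∑ ρ : Fin r, Real.exp (-∑ l ∈ insert k s, c l * pairGap ((fun i => (x i : ℝ)) ∘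
          ⇑(π * Equiv.swap (.inl (k, true) : PairedIndex m r) (.inr ρ))) l ^ 2) ≤
        r * Real.exp (-(c k * N ^ 2 / 1024)) *
          Real.exp (-∑ l ∈ s, c l * pairGap ((fun i => (x i : ℝ)) ∘ π) l ^ 2) := by
      intro π _
      have h4 : ∀ ρ : Fin r, Real.exp (-∑ l ∈ insert k s, c l * pairGap ((fun i => (x i : ℝ)) ∘
          ⇑(π * Equiv.swap (.inl (k, true) : PairedIndex m r) (.inr ρ))) l ^ 2) =
          Real.exp (-(c k * ((x (π (.inr ρ)) : ℝ) - x (π (.inl (k, false)))) ^ 2)) *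
          Real.exp (-∑ l ∈ s, c l * pairGap ((fun i => (x i : ℝ)) ∘ π) l ^ 2) := by
        intro ρ
        rw [Finset.sum_insert hk, h2, Finset.sum_congr rfl fun l hl => by rw [h1 π ρ l hl],
          neg_add, Real.exp_add]
      simp_rw [h4]
      rw [← Finset.sum_mul]
      refine mul_le_mul_of_nonneg_right ?_ (Real.exp_pos _).le
      exact sum_exp_neg_sq_dist_le (fun ρ => x (π (.inr ρ)))
        (fun a b hab => by simpa using hx hab) _ N (c k) hN hr (hc0 k) (hc k)
    refine (Finset.sum_le_sum h3).trans ?_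
    rw [← Finset.mul_sum, Finset.sum_insert hk, mul_add, neg_add, Real.exp_add]
    calc _ ≤ r * Real.exp (-(c k * N ^ 2 / 1024)) *
        ((2 * m + r).factorial * Real.exp (-(N ^ 2 / 1024 * ∑ k ∈ s, c k))) := by gcongr
      _ = _ := by rw [show N ^ 2 / 1024 * c k = c k * N ^ 2 / 1024 by ring]; ring

/-! ### An Esseen type inequality -/

/-- The Fourier transform of the indicator of `[-h, h]`. -/
noncomputable def boxFourier (h y : ℝ) : ℂ :=
  ∫ t in (-h)..h, Complex.exp ((t * y : ℝ) * Complex.I)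

theorem le_norm_boxFourier {h y : ℝ} (hh : 0 ≤ h) (hy : |y| * h ≤ 1) : h ≤ ‖boxFourier h y‖ := by
  have hint : IntervalIntegrable (fun t : ℝ => Complex.exp ((t * y : ℝ) * Complex.I))
      volume (-h) h :=
    (by fun_prop : Continuous _).intervalIntegrable _ _
  have h1 : (boxFourier h y).re = ∫ t in (-h)..h, Real.cos (t * y) := by
    have := Complex.reCLM.intervalIntegral_comp_comm hint
    rw [boxFourier]
    simp only [Complex.reCLM_apply, Complex.exp_ofReal_mul_I_re] at this
    exact this.symm
  have h2 : ∫ _t in (-h)..h, (1 / 2 : ℝ) ≤ ∫ t in (-h)..h, Real.cos (t * y) := by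
    refine intervalIntegral.integral_mono_on (by linarith) (by simp)
      ((by fun_prop : Continuous _).intervalIntegrable _ _) fun t ht => ?_
    have h3 : |t * y| ≤ 1 := by
      rw [abs_mul]
      have : |t| ≤ h := abs_le.2 ht
      nlinarith [abs_nonneg y, abs_nonneg t]
    have h4 : (t * y) ^ 2 ≤ 1 := by
      rw [← sq_abs]; nlinarith [abs_nonneg (t * y)]
    linarith [Real.one_sub_sq_div_two_le_cos (x := t * y)]
  rw [intervalIntegral.integral_const, smul_eq_mul, ← h1] at h2
  linarith [Complex.re_le_norm (boxFourier h y)]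

theorem sum_mul_norm_boxFourier_sq {Ω : Type*} [Fintype Ω] (a Y : Ω → ℝ) (h : ℝ) :
    ((∑ ω, a ω * ‖boxFourier h (Y ω)‖ ^ 2 : ℝ) : ℂ) =
      ∫ t in (-h)..h, ∫ s in (-h)..h,
        ∑ ω, (a ω : ℂ) * Complex.exp (((t - s) * Y ω : ℝ) * Complex.I) := by
  have h1 : ∀ y : ℝ, (starRingEnd ℂ) (boxFourier h y) =
      ∫ s in (-h)..h, Complex.exp ((-(s * y) : ℝ) * Complex.I) := by
    intro y
    rw [boxFourier, ← intervalIntegral.intervalIntegral_conj]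
    refine intervalIntegral.integral_congr fun s _ => ?_
    simp [← Complex.exp_conj]
  have h2 : ∀ t : ℝ, (∫ s in (-h)..h,
        ∑ ω, (a ω : ℂ) * Complex.exp (((t - s) * Y ω : ℝ) * Complex.I)) =
      ∑ ω, (a ω : ℂ) * (starRingEnd ℂ) (boxFourier h (Y ω)) *
        Complex.exp ((t * Y ω : ℝ) * Complex.I) := by
    intro t
    rw [intervalIntegral.integral_finsetSum fun ω _ =>
      (by fun_prop : Continuous _).intervalIntegrable _ _]
    refine Finset.sum_congr rfl fun ω _ => ?_
    rw [h1, ← intervalIntegral.integral_const_mul, ← intervalIntegral.integral_mul_const]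
    refine intervalIntegral.integral_congr fun s _ => ?_
    rw [mul_assoc, ← Complex.exp_add]
    congr 2
    push_cast; ring
  simp_rw [h2]
  rw [intervalIntegral.integral_finsetSum fun ω _ =>
      (by fun_prop : Continuous _).intervalIntegrable _ _]
  push_cast
  refine Finset.sum_congr rfl fun ω _ => ?_
  rw [intervalIntegral.integral_const_mul, mul_assoc]
  congr 1
  have := Complex.conj_mul' (boxFourier h (Y ω))
  rw [← this]
  simp [boxFourier]

theorem intervalIntegral_gaussian_le {b : ℝ} (hb : 0 < b) {h : ℝ} (hh : 0 ≤ h) (t : ℝ) :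
    ∫ s in (-h)..h, Real.exp (-b * (t - s) ^ 2) ≤ Real.sqrt (Real.pi / b) := by
  have hi : Integrable (fun s : ℝ => Real.exp (-b * (t - s) ^ 2)) :=
    (integrable_exp_neg_mul_sq hb).comp_sub_left t
  rw [intervalIntegral.integral_of_le (by linarith)]
  refine (setIntegral_le_integral hi
    (Filter.Eventually.of_forall fun s => (Real.exp_pos _).le)).trans (le_of_eq ?_)
  rw [integral_sub_left_eq_self (fun s => Real.exp (-b * s ^ 2)) volume t, integral_gaussian]

/-- An Esseen type inequality: a small ball estimate from Gaussian decay of the Fourier transform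
at low frequencies. -/
theorem sum_filter_abs_le_of_norm_le {Ω : Type*} [Fintype Ω] (a Y : Ω → ℝ) (ha : ∀ ω, 0 ≤ a ω)
    {h A b : ℝ} (hh : 0 < h) (hb : 0 < b) (hA : 0 ≤ A)
    (H : ∀ u : ℝ, |u| ≤ 2 * h →
      ‖∑ ω, (a ω : ℂ) * Complex.exp ((u * Y ω : ℝ) * Complex.I)‖ ≤ A * Real.exp (-b * u ^ 2)) :
    h * ∑ ω with |Y ω| * h ≤ 1, a ω ≤ 2 * A * Real.sqrt (Real.pi / b) := by
  have h1 : h ^ 2 * ∑ ω with |Y ω| * h ≤ 1, a ω ≤ ∑ ω, a ω * ‖boxFourier h (Y ω)‖ ^ 2 := by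
    rw [Finset.mul_sum]
    refine (Finset.sum_le_sum fun ω hω => ?_).trans
      (Finset.sum_le_sum_of_subset_of_nonneg (Finset.subset_univ _) fun ω _ _ =>
        mul_nonneg (ha ω) (sq_nonneg _))
    have := le_norm_boxFourier hh.le (Finset.mem_filter.1 hω).2
    rw [mul_comm]
    exact mul_le_mul_of_nonneg_left (by gcongr) (ha ω)
  have h2 : ∑ ω, a ω * ‖boxFourier h (Y ω)‖ ^ 2 ≤ A * Real.sqrt (Real.pi / b) * (2 * h) := by
    have h3 : ∑ ω, a ω * ‖boxFourier h (Y ω)‖ ^ 2 ≤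
        ‖((∑ ω, a ω * ‖boxFourier h (Y ω)‖ ^ 2 : ℝ) : ℂ)‖ := by
      rw [Complex.norm_real]; exact le_abs_self _
    refine h3.trans ?_
    rw [sum_mul_norm_boxFourier_sq]
    have h4 := intervalIntegral.norm_integral_le_of_norm_le_const (a := -h) (b := h)
      (C := A * Real.sqrt (Real.pi / b)) (f := fun t => ∫ s in (-h)..h,
        ∑ ω, (a ω : ℂ) * Complex.exp (((t - s) * Y ω : ℝ) * Complex.I)) (fun t ht => by
      rw [Set.uIoc_of_le (by linarith)] at ht
      have hc : IntervalIntegrable (fun s => A * Real.exp (-b * (t - s) ^ 2)) volume (-h) h :=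
        (by fun_prop : Continuous _).intervalIntegrable _ _
      have h5 := intervalIntegral.norm_integral_le_of_norm_le (μ := volume) (a := -h) (b := h)
        (f := fun s => ∑ ω, (a ω : ℂ) * Complex.exp (((t - s) * Y ω : ℝ) * Complex.I))
        (by linarith) (Filter.Eventually.of_forall fun s hs => H (t - s) (by
          rw [abs_le]; constructor <;> linarith [ht.1, ht.2, hs.1, hs.2])) hc
      refine h5.trans ?_
      rw [intervalIntegral.integral_const_mul]
      exact mul_le_mul_of_nonneg_left (intervalIntegral_gaussian_le hb hh.le t) hA)
    have h6 : |h - -h| = 2 * h := by rw [abs_of_pos] <;> linarith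
    rwa [h6] at h4
  refine le_of_mul_le_mul_left ?_ hh
  nlinarith

/-! ### Relocating one letter -/

/-- The permutation of `Fin (q + 1)` with `0 ↦ a` whose values at the remaining positions are in
the relative order prescribed by `σ`. -/
def relocate {q : ℕ} (a : Fin (q + 1)) (σ : Equiv.Perm (Fin q)) : Equiv.Perm (Fin (q + 1)) :=
  (Fin.cycleRange a).symm * Equiv.Perm.decomposeFin.symm (0, σ)

theorem relocate_zero {q : ℕ} (a : Fin (q + 1)) (σ : Equiv.Perm (Fin q)) :
    relocate a σ 0 = a := by
  simp [relocate]

theorem relocate_succ {q : ℕ} (a : Fin (q + 1)) (σ : Equiv.Perm (Fin q)) (j : Fin q) :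
    relocate a σ j.succ = a.succAbove (σ j) := by
  simp [relocate]

theorem relocate_bijective {q : ℕ} :
    Function.Bijective fun p : Fin (q + 1) × Equiv.Perm (Fin q) => relocate p.1 p.2 := by
  rw [Fintype.bijective_iff_injective_and_card]
  constructor
  · rintro ⟨a, σ⟩ ⟨b, τ⟩ h
    have h0 : relocate a σ = relocate b τ := h
    have hab : a = b := by rw [← relocate_zero a σ, h0, relocate_zero]
    subst hab
    congr 1
    ext1 j
    have := congrArg (fun g : Equiv.Perm (Fin (q + 1)) => g j.succ) h0
    simpa [relocate_succ] using this
  · simp [Fintype.card_perm, Nat.factorial_succ]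

theorem permForm_relocate {q : ℕ} (w y : Fin (q + 1) → ℝ) (a : Fin (q + 1))
    (σ : Equiv.Perm (Fin q)) :
    permForm w y (relocate a σ) =
      w 0 * ∑ i, y i - ∑ j, (w 0 - w j.succ) * y (a.succAbove (σ j)) := by
  have h : ∑ i, y i = y a + ∑ j, y (a.succAbove (σ j)) := by
    rw [Fin.sum_univ_succAbove y a, Equiv.sum_comp σ fun j => y (a.succAbove j)]
  rw [permForm, Fin.sum_univ_succ, relocate_zero, h]
  simp_rw [relocate_succ, sub_mul, Finset.sum_sub_distrib, ← Finset.mul_sum]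
  ring

/-- The differences `y (a.succAbove k) - y (b.succAbove k)` are nonnegative and add up to
`y b - y a`. -/
theorem permForm_relocate_sub {q : ℕ} (w y : Fin (q + 1) → ℝ) (hy : Monotone y) {d e : ℝ}
    (hw : ∀ j : Fin q, d ≤ w 0 - w j.succ ∧ w 0 - w j.succ ≤ e) (σ : Equiv.Perm (Fin q))
    {a b : Fin (q + 1)} (hab : a ≤ b) :
    d * (y b - y a) ≤ permForm w y (relocate b σ) - permForm w y (relocate a σ) ∧
      permForm w y (relocate b σ) - permForm w y (relocate a σ) ≤ e * (y b - y a) := by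
  have h : ∀ a, ∑ i, y i = y a + ∑ j, y (a.succAbove (σ j)) := fun a => by
    rw [Fin.sum_univ_succAbove y a, Equiv.sum_comp σ fun j => y (a.succAbove j)]
  have h1 : y b - y a = ∑ j, (y (a.succAbove (σ j)) - y (b.succAbove (σ j))) := by
    rw [Finset.sum_sub_distrib]; linarith [h a, h b]
  have h2 : permForm w y (relocate b σ) - permForm w y (relocate a σ) =
      ∑ j, (w 0 - w j.succ) * (y (a.succAbove (σ j)) - y (b.succAbove (σ j))) := by
    rw [permForm_relocate, permForm_relocate]
    simp_rw [mul_sub, Finset.sum_sub_distrib]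
    ring
  have h3 : ∀ j, 0 ≤ y (a.succAbove (σ j)) - y (b.succAbove (σ j)) := fun j => by
    refine sub_nonneg.2 (hy ?_)
    simp only [Fin.succAbove, Fin.lt_def, Fin.le_def] at hab ⊢
    split_ifs <;> simp <;> omega
  rw [h2, h1, Finset.mul_sum, Finset.mul_sum]
  exact ⟨Finset.sum_le_sum fun j _ => mul_le_mul_of_nonneg_right (hw j).1 (h3 j),
    Finset.sum_le_sum fun j _ => mul_le_mul_of_nonneg_right (hw j).2 (h3 j)⟩

theorem card_filter_permForm_fin_le {q : ℕ} (w : Fin (q + 1) → ℝ) (y : Fin (q + 1) → ℤ)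
    (hy : StrictMono y) {n δ : ℝ} (hn : ∀ i j, |(y i : ℝ) - y j| ≤ n) (hδ : 0 < δ)
    (hw : ∀ j : Fin q, δ / 2 ≤ w 0 - w j.succ ∧ w 0 - w j.succ ≤ 2 * δ) (z : ℝ) :
    ((q + 1 : ℕ) : ℝ) *
        (Finset.univ.filter fun g => |permForm w (fun i => (y i : ℝ)) g - z| ≤ 1).card ≤
      (8 / δ + 1) * (Finset.univ.filter fun g =>
        |permForm w (fun i => (y i : ℝ)) g - z| ≤ 1 + 2 * δ * n).card := by
  classical
  set Y : Fin (q + 1) → ℝ := fun i => (y i : ℝ)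
  have hY : Monotone Y := fun i j hij => by simpa [Y] using hy.monotone hij
  have key : ∀ P : Equiv.Perm (Fin (q + 1)) → Prop, ((Finset.univ.filter P).card : ℝ) =
      ∑ σ : Equiv.Perm (Fin q), ((Finset.univ.filter fun a => P (relocate a σ)).card : ℝ) := by
    intro P
    simp_rw [← Finset.sum_boole]
    rw [Finset.sum_comm,
      ← Fintype.sum_prod_type' (fun a σ => if P (relocate a σ) then (1 : ℝ) else 0)]
    exact (Function.Bijective.sum_comp relocate_bijective
      (fun g => if P g then (1 : ℝ) else 0)).symm
  rw [key, key, Finset.mul_sum, Finset.mul_sum]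
  refine Finset.sum_le_sum fun σ _ => ?_
  set s := Finset.univ.filter fun a => |permForm w Y (relocate a σ) - z| ≤ 1
  rcases s.eq_empty_or_nonempty with hs | ⟨b, hb⟩
  · rw [hs]; simp; positivity
  have hb1 := abs_le.1 (Finset.mem_filter.1 hb).2
  have hdist : ∀ a c, |permForm w Y (relocate a σ) - permForm w Y (relocate c σ)| ≤
        2 * δ * |Y a - Y c| ∧ δ / 2 * |Y a - Y c| ≤
        |permForm w Y (relocate a σ) - permForm w Y (relocate c σ)| := by
    have h0 : ∀ a c, c ≤ a → |permForm w Y (relocate a σ) - permForm w Y (relocate c σ)| ≤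
        2 * δ * |Y a - Y c| ∧ δ / 2 * |Y a - Y c| ≤
        |permForm w Y (relocate a σ) - permForm w Y (relocate c σ)| := by
      intro a c hac
      obtain ⟨h1, h2⟩ := permForm_relocate_sub w Y hY hw σ hac
      have h3 : 0 ≤ Y a - Y c := sub_nonneg.2 (hY hac)
      rw [abs_of_nonneg h3, abs_of_nonneg (le_trans (by positivity) h1)]
      exact ⟨h2, h1⟩
    intro a c
    rcases le_total c a with h | h
    · exact h0 a c h
    · rw [abs_sub_comm, abs_sub_comm (Y a)]; exact h0 c a h
  have hcard : (s.card : ℝ) ≤ 8 / δ + 1 := by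
    refine card_le_of_injOn_int s y hy.injective.injOn (l := Y b - 4 / δ) (by positivity)
      fun a ha => ?_
    have ha1 := abs_le.1 (Finset.mem_filter.1 ha).2
    have h1 := (hdist a b).2
    have h2 : |permForm w Y (relocate a σ) - permForm w Y (relocate b σ)| ≤ 2 :=
      abs_le.2 ⟨by linarith, by linarith⟩
    have h3 : |Y a - Y b| ≤ 4 / δ := by
      rw [le_div_iff₀ hδ]; nlinarith
    have h4 := abs_le.1 h3
    have h5 : 8 / δ = 2 * (4 / δ) := by ring
    change Y b - 4 / δ ≤ Y a ∧ Y a ≤ Y b - 4 / δ + 8 / δ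
    constructor <;> linarith
  have hall : (Finset.univ.filter fun a => |permForm w Y (relocate a σ) - z| ≤ 1 + 2 * δ * n) =
      Finset.univ := by
    refine Finset.filter_true_of_mem fun a _ => ?_
    have h1 := abs_le.1 ((hdist a b).1.trans
      (mul_le_mul_of_nonneg_left (hn a b) (by positivity)))
    exact abs_le.2 ⟨by linarith, by linarith⟩
  rw [hall, Finset.card_univ, Fintype.card_fin, mul_comm]
  gcongr

/-! ### From the scale of the largest weight to the unit scale -/

/-- The relocation estimate on an arbitrary finite set of positions. -/
theorem card_filter_permForm_le_of_sub {β : Type*} [Fintype β] [DecidableEq β] (w : β → ℝ)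
    (y : β → ℤ) (hy : Function.Injective y) {n δ : ℝ} (hn : ∀ i j, |(y i : ℝ) - y j| ≤ n)
    (hδ : 0 < δ) (b₀ : β) (hw : ∀ j, j ≠ b₀ → δ / 2 ≤ w b₀ - w j ∧ w b₀ - w j ≤ 2 * δ) (z : ℝ) :
    (Fintype.card β : ℝ) *
        (Finset.univ.filter fun g => |permForm w (fun i => (y i : ℝ)) g - z| ≤ 1).card ≤
      (8 / δ + 1) * (Finset.univ.filter fun g =>
        |permForm w (fun i => (y i : ℝ)) g - z| ≤ 1 + 2 * δ * n).card := by
  obtain ⟨q, hq⟩ : ∃ q, Fintype.card β = q + 1 :=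
    ⟨Fintype.card β - 1, (Nat.succ_pred_eq_of_pos (Fintype.card_pos_iff.2 ⟨b₀⟩)).symm⟩
  obtain ⟨e, he⟩ : ∃ e : Fin (q + 1) ≃ β, e 0 = b₀ := by
    let e := (Fintype.equivFinOfCardEq hq).symm
    exact ⟨e.trans (Equiv.swap (e 0) b₀), by simp⟩
  -- The letters in increasing order; `w` and `y` may be enumerated independently.
  let f : Fin (q + 1) ≃ β := (Tuple.sort (y ∘ e)).trans e
  have hf : StrictMono (y ∘ f) :=
    (Tuple.monotone_sort (y ∘ e)).strictMono_of_injective (hy.comp f.injective)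
  have hX : ∀ g : Equiv.Perm (Fin (q + 1)),
      permForm w (fun i => (y i : ℝ)) (Equiv.equivCongr e f g) =
      permForm (w ∘ e) (fun i => ((y ∘ f) i : ℝ)) g := by
    intro g
    unfold permForm
    rw [← Equiv.sum_comp e]
    simp
  have hcard : ∀ t : ℝ,
      (Finset.univ.filter fun g => |permForm w (fun i => (y i : ℝ)) g - z| ≤ t).card =
      (Finset.univ.filter fun g =>
        |permForm (w ∘ e) (fun i => ((y ∘ f) i : ℝ)) g - z| ≤ t).card := by
    intro t
    refine (Finset.card_equiv (Equiv.equivCongr e f) fun g => ?_).symm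
    simp only [Finset.mem_filter, Finset.mem_univ, true_and, hX]
  rw [hcard, hcard, hq]
  refine card_filter_permForm_fin_le _ _ hf (fun i j => hn _ _) hδ (fun j => ?_) z
  have := hw (e j.succ) (by rw [← he]; simp [Fin.succ_ne_zero])
  simpa [he] using this

theorem permForm_mul_ofSubtype {α : Type*} [Fintype α] [DecidableEq α] (p : α → Prop)
    [DecidablePred p] (w x : α → ℝ) (π : Equiv.Perm α) (h : Equiv.Perm {i // p i}) :
    permForm w x (π * Equiv.Perm.ofSubtype h) =
      permForm (fun i : {i // p i} => w i) (fun i : {i // p i} => x (π i)) h +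
        ∑ i : {i // ¬ p i}, w i * x (π i) := by
  unfold permForm
  rw [← Fintype.sum_subtype_add_sum_subtype p]
  congr 1
  · refine Finset.sum_congr rfl fun i _ => ?_
    rw [Equiv.Perm.mul_apply, Equiv.Perm.ofSubtype_apply_coe]
  · refine Finset.sum_congr rfl fun i _ => ?_
    rw [Equiv.Perm.mul_apply, Equiv.Perm.ofSubtype_apply_of_not_mem _ i.2]

/-- At least a third of the weights are at most half the largest one. -/
theorem card_le_three_mul_card_filter {α : Type*} [Fintype α] (w : α → ℝ)
    (hw : ∑ i, w i = 0) {δ : ℝ} (hδ : 0 < δ) (hw' : ∀ i, |w i| ≤ δ) :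
    (Fintype.card α : ℝ) ≤ 3 * (Finset.univ.filter fun i => w i ≤ δ / 2).card := by
  have h : ∀ i, δ / 2 - (3 * δ / 2) * (if w i ≤ δ / 2 then 1 else 0) ≤ w i := by
    intro i
    split_ifs with h
    · linarith [(abs_le.1 (hw' i)).1]
    · linarith
  have h1 := Finset.sum_le_sum fun i (_ : i ∈ Finset.univ) => h i
  rw [hw, Finset.sum_sub_distrib, ← Finset.mul_sum, Finset.sum_boole] at h1
  simp only [Finset.sum_const, Finset.card_univ, nsmul_eq_mul] at h1
  refine le_of_mul_le_mul_left ?_ (half_pos hδ)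
  linarith

/-- Passage from the scale `δ n` to the scale `1`, where `δ` is the largest weight. -/
theorem card_filter_permForm_le {α : Type*} [Fintype α] [DecidableEq α] (w : α → ℝ) (x : α → ℤ)
    (hx : Function.Injective x) {n δ : ℝ} (hn : ∀ i j, |(x i : ℝ) - x j| ≤ n) (hδ : 0 < δ)
    (hw : ∑ i, w i = 0) (i₀ : α) (hi₀ : w i₀ = δ) (hw' : ∀ i, |w i| ≤ δ) (z : ℝ) :
    (Fintype.card α : ℝ) *
        (Finset.univ.filter fun g => |permForm w (fun i => (x i : ℝ)) g - z| ≤ 1).card ≤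
      3 * (8 / δ + 1) * (Finset.univ.filter fun g =>
        |permForm w (fun i => (x i : ℝ)) g - z| ≤ 1 + 2 * δ * n).card := by
  classical
  -- The positions whose letters are rearranged.
  let p : α → Prop := fun i => i = i₀ ∨ w i ≤ δ / 2
  set H := Equiv.Perm {i // p i}
  have hHpos : (0 : ℝ) < Fintype.card H := by exact_mod_cast Fintype.card_pos
  have hp : (Fintype.card α : ℝ) ≤ 3 * Fintype.card {i // p i} := by
    refine (card_le_three_mul_card_filter w hw hδ hw').trans ?_
    rw [Fintype.card_subtype]
    gcongr with i
    exact Or.inr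
  have avg : ∀ t : ℝ, (Fintype.card H : ℝ) *
      (Finset.univ.filter fun g => |permForm w (fun i => (x i : ℝ)) g - z| ≤ t).card =
      ∑ π : Equiv.Perm α, ((Finset.univ.filter fun h : H => |permForm (fun i : {i // p i} => w i)
        (fun i : {i // p i} => (x (π i) : ℝ)) h -
          (z - ∑ i : {i // ¬ p i}, w i * x (π i))| ≤ t).card : ℝ) := by
    intro t
    have := sum_perm_mul_right_family (fun h : H => Equiv.Perm.ofSubtype h)
      (fun g => if |permForm w (fun i => (x i : ℝ)) g - z| ≤ t then (1 : ℝ) else 0)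
    rw [nsmul_eq_mul, Finset.sum_boole] at this
    rw [← this]
    refine Finset.sum_congr rfl fun π _ => ?_
    rw [Finset.sum_boole]
    simp_rw [permForm_mul_ofSubtype, sub_sub_eq_add_sub]
  have step : (Fintype.card {i // p i} : ℝ) * ((Fintype.card H : ℝ) *
        (Finset.univ.filter fun g => |permForm w (fun i => (x i : ℝ)) g - z| ≤ 1).card) ≤
      (8 / δ + 1) * ((Fintype.card H : ℝ) * (Finset.univ.filter fun g =>
        |permForm w (fun i => (x i : ℝ)) g - z| ≤ 1 + 2 * δ * n).card) := by
    rw [avg, avg, Finset.mul_sum, Finset.mul_sum]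
    refine Finset.sum_le_sum fun π _ => ?_
    refine card_filter_permForm_le_of_sub (fun i : {i // p i} => w i) (fun i => x (π i))
      (fun i j hij => Subtype.ext (π.injective (hx hij))) (fun i j => hn _ _) hδ
      ⟨i₀, Or.inl rfl⟩ (fun j hj => ?_) _
    have hj' : w j ≤ δ / 2 := j.2.resolve_left fun h => hj (Subtype.ext h)
    have := abs_le.1 (hw' j)
    simp only [hi₀]
    constructor <;> linarith
  refine le_of_mul_le_mul_left ?_ hHpos
  have h0 : (0 : ℝ) ≤ (Fintype.card H : ℝ) *
      (Finset.univ.filter fun g => |permForm w (fun i => (x i : ℝ)) g - z| ≤ 1).card := by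
    positivity
  nlinarith [mul_le_mul_of_nonneg_right hp h0]

/-! ### Small balls at the scale of the largest weight -/

/-- Cauchy–Schwarz separates the tilt from the decay. -/
theorem norm_sum_cexp_permForm_le_gaussian {m r : ℕ} (hm : 2 ≤ m) (hr : 2 * m ≤ r)
    (hr' : r ≤ 2 * m + 3) (w : PairedIndex m r → ℝ) (x : PairedIndex m r → ℤ)
    (hx : Function.Injective x) (hn : ∀ i j, |(x i : ℝ) - x j| ≤ (2 * m + r : ℕ))
    (hw : ∑ i, w i = 0) (hw2 : ∑ i, w i ^ 2 = 1) (hv : 1 / 3 ≤ ∑ k, pairGap w k ^ 2) {δ : ℝ}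
    (hδ : 0 < δ) (hδ1 : δ ≤ 1) (hw' : ∀ i, |w i| ≤ δ) {p u : ℝ}
    (hp : |p| * (2 * m + r : ℕ) ≤ 1) (hu : |u| * (δ * (2 * m + r : ℕ)) ≤ 1) :
    ‖∑ π, Complex.exp ((p + u * Complex.I) * permForm w (fun i => (x i : ℝ)) π)‖ ≤
      ((2 * m + r).factorial * Real.exp 18) *
        Real.exp (-((2 * m + r : ℕ) ^ 2 / 393216) * u ^ 2) := by
  set n : ℕ := 2 * m + r with hn_def
  set X : PairedIndex m r → ℝ := fun i => (x i : ℝ)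
  have hm' : (2 : ℝ) ≤ m := by exact_mod_cast hm
  have hrR : 2 * (m : ℝ) ≤ r := by exact_mod_cast hr
  have hrR' : (r : ℝ) ≤ 2 * m + 3 := by exact_mod_cast hr'
  have hnR : (n : ℝ) = 2 * m + r := by rw [hn_def]; push_cast; ring
  have hn0 : (0 : ℝ) < n := by linarith
  have hgap : ∀ k, |pairGap w k| ≤ 2 * δ := fun k => by
    refine (abs_sub _ _).trans ?_
    linarith [hw' (.inl (k, true)), hw' (.inl (k, false))]
  have hprod : ∀ (π : Equiv.Perm (PairedIndex m r)) k,
      |pairGap w k * pairGap (X ∘ π) k / 2| ≤ δ * n := fun π k => by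
    rw [abs_div, abs_mul, abs_two]
    have := mul_le_mul (hgap k) (hn (π (.inl (k, true))) (π (.inl (k, false)))) (abs_nonneg _)
      (by positivity)
    have h2 : pairGap (X ∘ π) k = (x (π (.inl (k, true))) : ℝ) - x (π (.inl (k, false))) := rfl
    rw [h2]; linarith
  have h1 := norm_sum_cexp_permForm_le w X p u
    (fun π k => by
      rw [abs_mul]
      calc |p| * |pairGap w k * pairGap (X ∘ π) k / 2| ≤ |p| * (δ * n) := by
            gcongr; exact hprod π k
        _ ≤ |p| * (1 * n) := by gcongr
        _ ≤ 1 := by rwa [one_mul])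
    (fun π k => by
      rw [abs_mul]
      exact (mul_le_mul_of_nonneg_left (hprod π k) (abs_nonneg _)).trans hu)
  refine h1.trans ((Real.sum_mul_le_sqrt_mul_sqrt _ _ _).trans ?_)
  have hf : (0 : ℝ) < n.factorial := by positivity
  have hA : ∑ π, Real.exp (p * permForm w X π) ^ 2 ≤ n.factorial * Real.exp 36 := by
    have h2 := sum_exp_permForm_le (by omega) w X hw hw2 n hn (2 * p)
    refine le_trans (le_of_eq (Finset.sum_congr rfl fun π _ => ?_)) (h2.trans ?_)
    · rw [← Real.exp_nat_mul]; congr 1; push_cast; ring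
    · rw [← hn_def]
      refine mul_le_mul_of_nonneg_left (Real.exp_le_exp.2 ?_) hf.le
      have h3 : |2 * p * n * ((n : ℝ) - 1) / (2 * m)| ≤ 6 := by
        rw [abs_div, abs_of_pos (show (0 : ℝ) < 2 * m by linarith), div_le_iff₀ (by linarith),
          abs_mul, abs_mul, abs_mul, abs_two, abs_of_pos hn0,
          abs_of_pos (show (0 : ℝ) < n - 1 by linarith)]
        have : (n : ℝ) - 1 ≤ 6 * m := by linarith
        nlinarith [mul_le_mul_of_nonneg_right hp (show (0 : ℝ) ≤ n - 1 by linarith)]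
      have h4 := sq_le_sq' (abs_le.1 h3).1 (abs_le.1 h3).2
      linarith
  have hB : ∑ π, Real.exp (-(u ^ 2 * pairQuad w X π / 128)) ^ 2 ≤
      n.factorial * Real.exp (-(n ^ 2 / 196608 * u ^ 2)) := by
    have h2 := sum_exp_neg_sum_pairGap_sq_le x hx n (by linarith) (by linarith)
      (fun k => u ^ 2 / 64 * pairGap w k ^ 2) (fun k => by positivity) (fun k => ?_) Finset.univ
    · refine le_trans (le_of_eq (Finset.sum_congr rfl fun π _ => ?_)) (h2.trans ?_)
      · rw [← Real.exp_nat_mul, pairQuad]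
        congr 1
        simp_rw [mul_assoc (u ^ 2 / 64), ← Finset.mul_sum]
        push_cast
        ring
      · refine mul_le_mul_of_nonneg_left (Real.exp_le_exp.2 (neg_le_neg ?_)) hf.le
        rw [← Finset.mul_sum]
        have : (n : ℝ) ^ 2 / 1024 * (u ^ 2 / 64 * (1 / 3)) ≤
            n ^ 2 / 1024 * (u ^ 2 / 64 * ∑ k, pairGap w k ^ 2) := by gcongr
        linarith
    · have h3 : (|u| * (δ * n)) ^ 2 ≤ 1 := pow_le_one₀ (by positivity) hu
      have h4 : pairGap w k ^ 2 ≤ (2 * δ) ^ 2 := by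
        rw [← sq_abs]; exact pow_le_pow_left₀ (abs_nonneg _) (hgap k) 2
      rw [mul_pow, sq_abs] at h3
      calc u ^ 2 / 64 * pairGap w k ^ 2 * (n : ℝ) ^ 2 ≤ u ^ 2 / 64 * (2 * δ) ^ 2 * (n : ℝ) ^ 2 := by
            gcongr
        _ ≤ 256 := by nlinarith
  calc _ ≤ Real.sqrt (n.factorial * Real.exp 36) *
        Real.sqrt (n.factorial * Real.exp (-(n ^ 2 / 196608 * u ^ 2))) := by gcongr
    _ = _ := by
      rw [← Real.sqrt_mul (by positivity)]
      rw [show (n.factorial * Real.exp 36) * (n.factorial * Real.exp (-(n ^ 2 / 196608 * u ^ 2))) =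
        ((n.factorial * Real.exp 18) * Real.exp (-(n ^ 2 / 393216) * u ^ 2)) ^ 2 by
          rw [mul_pow, mul_pow, ← Real.exp_nat_mul, ← Real.exp_nat_mul,
            mul_mul_mul_comm, ← sq]
          rw [mul_assoc]
          congr 3 <;> push_cast <;> ring_nf]
      exact Real.sqrt_sq (by positivity)

/-- Small balls at the scale `δ n`, for positions already split into pairs. -/
theorem card_filter_permForm_le_exp_of_paired {m r : ℕ} (hm : 2 ≤ m) (hr : 2 * m ≤ r)
    (hr' : r ≤ 2 * m + 3) (w : PairedIndex m r → ℝ) (x : PairedIndex m r → ℤ)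
    (hx : Function.Injective x) (hn : ∀ i j, |(x i : ℝ) - x j| ≤ (2 * m + r : ℕ))
    (hw : ∑ i, w i = 0) (hw2 : ∑ i, w i ^ 2 = 1) (hv : 1 / 3 ≤ ∑ k, pairGap w k ^ 2) {δ : ℝ}
    (hδ : 0 < δ) (hδ1 : δ ≤ 1) (hw' : ∀ i, |w i| ≤ δ) (L : ℝ) :
    ((Finset.univ.filter fun g => |permForm w (fun i => (x i : ℝ)) g - L * (2 * m + r : ℕ)| ≤
        3 * δ * (2 * m + r : ℕ)).card : ℝ) ≤
      (2 * m + r).factorial *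
        (6 * Real.exp 21 * Real.sqrt (Real.pi * 393216) * δ * Real.exp (-|L|)) := by
  have hgauss := fun p u => norm_sum_cexp_permForm_le_gaussian hm hr hr' w x hx hn hw hw2 hv
    hδ hδ1 hw' (p := p) (u := u)
  set n : ℕ := 2 * m + r with hn_def
  set X : PairedIndex m r → ℝ := fun i => (x i : ℝ)
  have hn0 : (0 : ℝ) < n := by
    have : 0 < n := by omega
    exact_mod_cast this
  obtain ⟨s, hs, hsL⟩ : ∃ s : ℝ, |s| = 1 ∧ s * L = |L| := by
    rcases le_total 0 L with h | h
    · exact ⟨1, by simp, by rw [abs_of_nonneg h, one_mul]⟩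
    · exact ⟨-1, by simp, by rw [abs_of_nonpos h]; ring⟩
  have hs1 : |s / n| * n ≤ 1 := by
    rw [abs_div, hs, abs_of_pos hn0, div_mul_cancel₀ _ hn0.ne']
  have hh : 0 < 1 / (3 * δ * n) := by positivity
  have h1 := sum_filter_abs_le_of_norm_le (fun π => Real.exp (s / n * permForm w X π))
    (fun π => permForm w X π - L * n) (fun π => (Real.exp_pos _).le) hh
    (A := n.factorial * Real.exp 18) (b := (n : ℝ) ^ 2 / 393216) (by positivity) (by positivity)
    (fun u hu => by
      have h2 : ∑ π, ((Real.exp (s / n * permForm w X π) : ℝ) : ℂ) *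
          Complex.exp ((u * (permForm w X π - L * n) : ℝ) * Complex.I) =
          Complex.exp ((-(u * (L * n)) : ℝ) * Complex.I) *
          ∑ π, Complex.exp (((s / n : ℝ) + u * Complex.I) * permForm w X π) := by
        rw [Finset.mul_sum]
        refine Finset.sum_congr rfl fun π _ => ?_
        rw [Complex.ofReal_exp, ← Complex.exp_add, ← Complex.exp_add]
        congr 1
        push_cast
        ring
      rw [h2, norm_mul, Complex.norm_exp_ofReal_mul_I, one_mul]
      refine hgauss _ u hs1 ?_
      have h3 : |u| * (δ * n) ≤ 2 * (1 / (3 * δ * n)) * (δ * n) := by gcongr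
      have h4 : 2 * (1 / (3 * δ * n)) * (δ * n) = 2 / 3 := by field_simp
      linarith)
  have hev : (Finset.univ.filter fun π => |permForm w X π - L * n| * (1 / (3 * δ * n)) ≤ 1) =
      Finset.univ.filter fun π => |permForm w X π - L * n| ≤ 3 * δ * n := by
    refine Finset.filter_congr fun π _ => ?_
    rw [mul_one_div, div_le_one (by positivity)]
  rw [hev] at h1
  set S := Finset.univ.filter fun π => |permForm w X π - L * n| ≤ 3 * δ * n
  -- On the event the tilt is at least `exp (|L| - 3)`.
  have h5 : (S.card : ℝ) * Real.exp (|L| - 3) ≤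
      ∑ π ∈ S, Real.exp (s / n * permForm w X π) := by
    rw [← nsmul_eq_mul]
    refine Finset.card_nsmul_le_sum _ _ _ fun π hπ => Real.exp_le_exp.2 ?_
    have h6 : |s / n * (permForm w X π - L * n)| ≤ 3 := by
      rw [abs_mul, abs_div, hs, abs_of_pos hn0]
      calc 1 / (n : ℝ) * |permForm w X π - L * n| ≤ 1 / n * (3 * δ * n) := by
            gcongr; exact (Finset.mem_filter.1 hπ).2
        _ = 3 * δ := by field_simp
        _ ≤ 3 := by linarith
    have h7 : s / n * (permForm w X π - L * n) = s / n * permForm w X π - |L| := by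
      rw [← hsL]; field_simp
    rw [h7] at h6
    linarith [(abs_le.1 h6).1]
  have h8 : Real.sqrt (Real.pi / ((n : ℝ) ^ 2 / 393216)) = Real.sqrt (Real.pi * 393216) / n := by
    rw [div_div_eq_mul_div, Real.sqrt_div (by positivity), Real.sqrt_sq hn0.le]
  rw [h8, one_div, inv_mul_le_iff₀ (by positivity)] at h1
  have h9 := h5.trans h1
  rw [← le_div_iff₀ (Real.exp_pos _)] at h9
  refine h9.trans (le_of_eq ?_)
  rw [show (21 : ℝ) = 18 + 3 by norm_num, Real.exp_add, Real.exp_sub, Real.exp_neg]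
  field_simp
  ring

theorem card_filter_permForm_le_exp {n : ℕ} (hn8 : 8 ≤ n) (w : Fin n → ℝ) (x : Fin n → ℤ)
    (hx : Function.Injective x) (hn : ∀ i j, |(x i : ℝ) - x j| ≤ n)
    (hw : ∑ i, w i = 0) (hw2 : ∑ i, w i ^ 2 = 1) {δ : ℝ}
    (hδ : 0 < δ) (hδ1 : δ ≤ 1) (hw' : ∀ i, |w i| ≤ δ) (L : ℝ) :
    ((Finset.univ.filter fun g => |permForm w (fun i => (x i : ℝ)) g - L * n| ≤
        3 * δ * n).card : ℝ) ≤
      n.factorial * (6 * Real.exp 21 * Real.sqrt (Real.pi * 393216) * δ * Real.exp (-|L|)) := by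
  obtain ⟨m, r, hm, hr, hr', rfl⟩ : ∃ m r : ℕ, 2 ≤ m ∧ 2 * m ≤ r ∧ r ≤ 2 * m + 3 ∧
      n = 2 * m + r := ⟨n / 4, n - 2 * (n / 4), by omega, by omega, by omega, by omega⟩
  let e₀ : PairedIndex m r ≃ Fin (2 * m + r) :=
    Fintype.equivFinOfCardEq (by simp; ring)
  obtain ⟨τ, hτ⟩ := exists_perm_sum_pairGap_sq (by omega) hr' (w ∘ e₀)
    ((Equiv.sum_comp e₀ w).trans hw) ((Equiv.sum_comp e₀ fun i => w i ^ 2).trans hw2)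
  let e := τ.trans e₀
  have h := card_filter_permForm_le_exp_of_paired hm hr hr' (w ∘ e) (x ∘ e)
    (hx.comp e.injective) (fun i j => hn _ _) ((Equiv.sum_comp e w).trans hw)
    ((Equiv.sum_comp e fun i => w i ^ 2).trans hw2) hτ hδ hδ1 (fun i => hw' _) L
  refine le_trans (le_of_eq ?_) h
  congr 1
  refine Finset.card_equiv e.symm.permCongr fun π => ?_
  have := permForm_comp_equiv e w (fun i => (x i : ℝ)) π
  simp only [Finset.mem_filter, Finset.mem_univ, true_and]
  rw [← this]
  rfl

theorem uniformPermMeasure_real_filter {n : ℕ} (P : Equiv.Perm (Fin n) → Prop) [DecidablePred P] :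
    (uniformPermMeasure n).real {π | P π} = (Finset.univ.filter P).card / n.factorial := by
  rw [Measure.real, uniformPermMeasure,
    PMF.toMeasure_uniformOfFintype_apply {π | P π} MeasurableSpace.measurableSet_top]
  simp [Fintype.card_subtype, Fintype.card_perm]

/-- Small balls at the scale `1`, for a weight vector whose largest entry in absolute value is
positive. -/
theorem card_filter_permForm_le_div_mul_exp {n : ℕ} (hn8 : 8 ≤ n) (w : Fin n → ℝ) (x : Fin n → ℤ)
    (hx : Function.Injective x) (hn : ∀ i j, |(x i : ℝ) - x j| ≤ n)
    (hw : ∑ i, w i = 0) (hw2 : ∑ i, w i ^ 2 = 1) (i₀ : Fin n) (hi₀ : 0 < w i₀)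
    (hw' : ∀ i, |w i| ≤ w i₀) (L : ℝ) :
    n * ((Finset.univ.filter fun g => |permForm w (fun i => (x i : ℝ)) g - L * n| ≤ 1).card : ℝ) ≤
      n.factorial * (162 * Real.exp 21 * Real.sqrt (Real.pi * 393216) * Real.exp (-|L|)) := by
  set δ := w i₀
  have hδ1 : δ ≤ 1 := by
    have : δ ^ 2 ≤ 1 := by
      rw [← hw2]
      exact Finset.single_le_sum (f := fun i => w i ^ 2) (fun i _ => sq_nonneg _)
        (Finset.mem_univ i₀)
    nlinarith
  -- `1 = ∑ wᵢ² ≤ n δ²`; hence `δ n` is at least the unit scale.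
  have hδn : 1 ≤ δ * n := by
    have h1 : (1 : ℝ) ≤ n * δ ^ 2 := by
      rw [← hw2]
      refine (Finset.sum_le_card_nsmul _ _ (δ ^ 2) fun i _ => ?_).trans (by simp)
      rw [← sq_abs]; exact pow_le_pow_left₀ (abs_nonneg _) (hw' i) 2
    have h2 : (0 : ℝ) ≤ n := by positivity
    nlinarith
  have hA := card_filter_permForm_le w x hx hn hi₀ hw i₀ rfl hw' (L * n)
  rw [Fintype.card_fin] at hA
  refine hA.trans ?_
  have hB := card_filter_permForm_le_exp hn8 w x hx hn hw hw2 hi₀ hδ1 hw' L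
  have hsub : ((Finset.univ.filter fun g =>
      |permForm w (fun i => (x i : ℝ)) g - L * n| ≤ 1 + 2 * δ * n).card : ℝ) ≤
      (Finset.univ.filter fun g =>
      |permForm w (fun i => (x i : ℝ)) g - L * n| ≤ 3 * δ * n).card := by
    gcongr with g
    linarith
  have hcoef : 3 * (8 / δ + 1) ≤ 27 / δ := by
    have : 1 ≤ 1 / δ := by rw [le_div_iff₀ hi₀]; linarith
    have h2 : 27 / δ = 24 / δ + 3 * (1 / δ) := by ring
    have h3 : 3 * (8 / δ + 1) = 24 / δ + 3 := by ring
    linarith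
  calc _ ≤ 27 / δ * (n.factorial *
        (6 * Real.exp 21 * Real.sqrt (Real.pi * 393216) * δ * Real.exp (-|L|))) := by
        gcongr
        exact hsub.trans hB
    _ = _ := by field_simp; ring

theorem lemma4 :
    ∃ C c : ℝ, 0 < C ∧ 0 < c ∧
      ∀ (n : ℕ), 2 ≤ n → ∀ (w : Fin n → ℝ),
        ∑ i : Fin n, w i = 0 → ∑ i : Fin n, w i ^ 2 = 1 →
        ∀ L : ℝ,
          (uniformPermMeasure n).real
              {π : Equiv.Perm (Fin n) | |permLinearForm w π - L * (n : ℝ)| ≤ 1} ≤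
            C / (n : ℝ) * Real.exp (-c * |L|) := by
  set K : ℝ := 162 * Real.exp 21 * Real.sqrt (Real.pi * 393216)
  have hK : 0 < K := by positivity
  refine ⟨K + 8 * Real.exp 8, 1, by positivity, one_pos, fun n hn2 w hw hw2 L => ?_⟩
  have hn0 : (0 : ℝ) < n := by exact_mod_cast (by omega : 0 < n)
  have hf : (0 : ℝ) < n.factorial := by positivity
  let x : Fin n → ℤ := fun i => (i : ℕ) + 1
  have hx : Function.Injective x := fun i j hij => by
    simp only [x, add_left_inj, Nat.cast_inj] at hij
    exact Fin.ext hij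
  have hX : ∀ w : Fin n → ℝ, ∀ π, permLinearForm w π = permForm w (fun i => (x i : ℝ)) π := by
    intro w π
    simp [permLinearForm, permForm, x]
  have hxb : ∀ i, 1 ≤ (x i : ℝ) ∧ (x i : ℝ) ≤ n := fun i => by
    have h1 : (1 : ℤ) ≤ x i := by simp [x]
    have h2 : x i ≤ n := by simp only [x]; have := i.2; omega
    exact ⟨by exact_mod_cast h1, by exact_mod_cast h2⟩
  have hn : ∀ i j, |(x i : ℝ) - x j| ≤ n := fun i j =>
    abs_le.2 ⟨by linarith [hxb i, hxb j], by linarith [hxb i, hxb j]⟩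
  rw [uniformPermMeasure_real_filter, neg_one_mul, div_mul_eq_mul_div,
    div_le_div_iff₀ hf hn0]
  rcases lt_or_ge n 8 with hn8 | hn8
  · -- For bounded `n` the event is empty unless `|L| ≤ 8`.
    rcases (Finset.univ.filter fun π => |permLinearForm w π - L * n| ≤ 1).eq_empty_or_nonempty
      with h | ⟨π, hπ⟩
    · rw [h]; simp; positivity
    have hπ' := (Finset.mem_filter.1 hπ).2
    have hwi : ∀ i, |w i| ≤ 1 := fun i => by
      rw [← sq_le_one_iff_abs_le_one, ← hw2]
      exact Finset.single_le_sum (f := fun i => w i ^ 2) (fun i _ => sq_nonneg _)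
        (Finset.mem_univ i)
    have hbound : |permLinearForm w π| ≤ n * n := by
      rw [hX]
      refine (Finset.abs_sum_le_sum_abs _ _).trans
        ((Finset.sum_le_card_nsmul _ _ (n : ℝ) fun i _ => ?_).trans (by simp))
      rw [abs_mul, abs_of_pos (by linarith [hxb (π i)] : (0 : ℝ) < x (π i))]
      nlinarith [hwi i, (hxb (π i)).1, (hxb (π i)).2, abs_nonneg (w i)]
    have hL : |L| ≤ 8 := by
      have h1 : |L * n| ≤ 1 + n * n := by
        have := abs_sub_abs_le_abs_sub (L * n) (permLinearForm w π)
        rw [abs_sub_comm] at this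
        linarith
      rw [abs_mul, abs_of_pos hn0] at h1
      have h2 : (n : ℝ) ≤ 7 := by exact_mod_cast (by omega : n ≤ 7)
      have h3 : (1 : ℝ) ≤ n := by exact_mod_cast (by omega : 1 ≤ n)
      nlinarith
    have hc : ((Finset.univ.filter fun π => |permLinearForm w π - L * n| ≤ 1).card : ℝ) ≤
        n.factorial := by
      have := Finset.card_le_univ (Finset.univ.filter fun π => |permLinearForm w π - L * n| ≤ 1)
      rw [Fintype.card_perm, Fintype.card_fin] at this
      exact_mod_cast this
    have h8 : (n : ℝ) ≤ 8 := by exact_mod_cast hn8.le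
    have he : 1 ≤ Real.exp 8 * Real.exp (-|L|) := by
      rw [← Real.exp_add]; exact Real.one_le_exp (by linarith)
    calc _ ≤ (n.factorial : ℝ) * 8 := by gcongr
      _ ≤ (K + 8 * Real.exp 8) * Real.exp (-|L|) * n.factorial := by
        rw [mul_comm]
        gcongr
        nlinarith [mul_pos hK (Real.exp_pos (-|L|))]
  · have main : (n : ℝ) *
        ((Finset.univ.filter fun π => |permLinearForm w π - L * n| ≤ 1).card : ℝ) ≤
        n.factorial * (K * Real.exp (-|L|)) := by
      have : Nonempty (Fin n) := ⟨⟨0, by omega⟩⟩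
      obtain ⟨i₀, hi₀⟩ := Finite.exists_max fun i => |w i|
      have hpos : 0 < |w i₀| := by
        rw [abs_pos]
        intro h
        have h0 : ∀ i, w i = 0 := fun i => by
          have := hi₀ i
          rw [h, abs_zero] at this
          exact abs_nonpos_iff.1 this
        simp [h0] at hw2
      rcases le_total 0 (w i₀) with h | h
      · rw [abs_of_nonneg h] at hpos hi₀
        simp_rw [hX]
        exact card_filter_permForm_le_div_mul_exp hn8 w x hx hn hw hw2 i₀ hpos hi₀ L
      · -- The event is unchanged when `w` and `L` change sign.
        rw [abs_of_nonpos h] at hpos hi₀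
        have := card_filter_permForm_le_div_mul_exp hn8 (fun i => -w i) x hx hn (by simpa using hw)
          (by simpa using hw2) i₀ hpos (by simpa using hi₀) (-L)
        rw [abs_neg] at this
        refine le_trans (le_of_eq ?_) this
        congr 3
        refine Finset.filter_congr fun π _ => ?_
        have h1 : permForm (fun i => -w i) (fun i => (x i : ℝ)) π = -permLinearForm w π := by
          rw [hX]; simp [permForm]
        rw [h1, ← abs_neg]
        ring_nf
    have h2 : 0 ≤ 8 * Real.exp 8 * Real.exp (-|L|) * n.factorial := by positivity
    nlinarith
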